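/- Let $k\ge 2$. Call a set $E\subseteq H^k$ of $k$-tuples on a finite set $H$ a *$k$-full hypergraph* if $E=E^*\cup E^{<k}$, where $E^*$ is symmetric and holds only on tuples of $k$ distinct elements, and $E^{<k}$ is the set of all $k$-tuples with fewer than $k$ distinct entries. A *template* of arity $k$ is a sequence $\mathcal H=\langle (H_n,E_n):n<\omega\rangle$ of $k$-full hypergraphs on vertex sets $H_n=\{0,\dots,|H_n|-1\}$ for which there is a function $f:\omega\to\omega\setminus\{0\}$ with $f(n)\to\infty$ such that for all $n$: $f(n)\le |H_n|<\aleph_0$, and for any $f(n)$ many $(k-1)$-tuples $\bar\imath^{\,\ell}$ $(\ell<f(n))$ from $H_n$ there is $s\in H_n$ with $\langle s\rangle^\smallfrown\bar\imath^{\,\ell}\in E_n$ for all $\ell<f(n)$. Let $X_{\mathcal H}$ be the tree of finite sequences $\eta$ with $\eta(n)\in H_n$ for all $n<\operatorname{lgn}(\eta)$. Let $T_0(\mathcal H)$ be the universal theory, in the language with equality, a $k$-place relation $R$ and unary predicates $Q_\eta$ $(\eta\in X_{\mathcal H})$, which says: $R$ is symmetric and holds only on tuples of distinct elements; $Q_{\langle\rangle}$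 holds of everything, and $Q_\nu\subseteq Q_\eta$ when $\eta\trianglelefteq\nu$; for each $\eta\in X_{\mathcal H}$ of length $m$ the predicates $Q_{\eta^\smallfrown\langle i\rangle}$ $(i\in H_m)$ partition $Q_\eta$; and whenever $\eta_0,\dots,\eta_{k-1}\in X_{\mathcal H}$ and $n<\min_i\operatorname{lgn}(\eta_i)$ are such that $\langle\eta_0(n),\dots,\eta_{k-1}(n)\rangle\notin E_n$, then $R(x_0,\dots,x_{k-1})$ fails for all $x_0\in Q_{\eta_0},\dots,x_{k-1}\in Q_{\eta_{k-1}}$. Let $\mathcal D$ be an ultrafilter on an infinite set $I$ with $|I|=\lambda$. It is *regular* if there is a family $\{X_\alpha:\alpha<\lambda\}\subseteq\mathcal D$ such that each $i\in I$ lies in only finitely many $X_\alpha$. It is *flexible* if for every nonstandard integer $\langle n_i:i\in I\rangle/\mathcal D$ (that is, $n_i\in\mathbb N$ and $\{i:n_i>m\}\in\mathcal D$ for every $m\in\mathbb N$) there is $\{X_\alpha:\alpha<\lambda\}\subseteq\mathcal D$ with $|\{\alpha<\lambda:i\in X_\alpha\}|\le n_i$ for all $i\in I$. It is *good for the random graph*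 if for every infinite set $S$ and all disjoint $A,B\subseteq S^I/\mathcal D$ with $|A|+|B|\le\lambda$ there is an internal set $P\subseteq S^I/\mathcal D$ (an ultraproduct of subsets of $S$) with $A\subseteq P$ and $B\cap P=\emptyset$. **Theorem.** Let $\mathcal H$ be a template of arity $k\ge 2$, let $T$ be the model completion of $T_0(\mathcal H)$, let $M\models T$, and let $\mathcal D$ be a regular ultrafilter on an infinite set $I$, $|I|=\lambda$, which is flexible and good for the random graph. Then the ultrapower $M^I/\mathcal D$ is $\lambda^+$-saturated: over every set of at most $\lambda$ parameters, every $1$-type is realized. -/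

import Mathlib

open FirstOrder

universe u

/-! ### Hypergraphs and templates -/

/-- `E`, a set of `k`-tuples from the vertex set `V`, makes `V` a `k`-full hypergraph: `E` is the
union of a `k`-uniform hypergraph `E'` (symmetric, holding only on tuples of `k` distinct vertices)
and of the set of all `k`-tuples with fewer than `k` distinct entries. -/
def IsFullHypergraph {V : Type*} {k : ℕ} (E : Set (Fin k → V)) : Prop :=
  ∃ E' : Set (Fin k → V),
    (∀ x ∈ E', Function.Injective x) ∧
    (∀ x ∈ E', ∀ σ : Equiv.Perm (Fin k), x ∘ σ ∈ E') ∧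
    E = E' ∪ {x | ¬ Function.Injective x}

/-- The requirements that the growth function `f` of a template has to meet, for the sequence of
hypergraphs `(Fin (H n), E n)` of arity `d + 1`. -/
structure IsGrowthFunction {d : ℕ} (H : ℕ → ℕ) (E : ∀ n, Set (Fin (d + 1) → Fin (H n)))
    (f : ℕ → ℕ) : Prop where
  pos : ∀ n, 0 < f n
  tendsto : Filter.Tendsto f Filter.atTop Filter.atTop
  le_card : ∀ n, f n ≤ H n
  /-- Extension: any `f n` many `d`-tuples of vertices have a common neighbour. -/
  extension : ∀ n, ∀ i : Fin (f n) → Fin d → Fin (H n),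
    ∃ s : Fin (H n), ∀ l, (Fin.cons s (i l) : Fin (d + 1) → Fin (H n)) ∈ E n

/-- A template of arity `k = d + 1 ≥ 2`: a sequence of finite `k`-full hypergraphs
`(Fin (H n), E n)` that admits a growth function. -/
structure Template (d : ℕ) where
  one_le : 1 ≤ d
  H : ℕ → ℕ
  E : ∀ n, Set (Fin (d + 1) → Fin (H n))
  full : ∀ n, IsFullHypergraph (E n)
  exists_growth : ∃ f : ℕ → ℕ, IsGrowthFunction H E f

namespace Template

variable {d : ℕ} (𝓗 : Template d)

/-- The tree of finite sequences `η` with `η n < H n` for all `n < lgn η`. -/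
def Node : Type := (m : ℕ) × ((i : Fin m) → Fin (𝓗.H i))

variable {𝓗}

/-- The length of a finite sequence. -/
def Node.lgn (η : 𝓗.Node) : ℕ := η.1

/-- The entry `η n`, for `n < lgn η`. -/
def Node.entry (η : 𝓗.Node) (n : ℕ) (hn : n < η.lgn) : Fin (𝓗.H n) := η.2 ⟨n, hn⟩

/-- The empty sequence. -/
def Node.root : 𝓗.Node := ⟨0, fun i => i.elim0⟩

/-- The sequence `η` with the further entry `i` at its end. -/
def Node.snoc (η : 𝓗.Node) (i : Fin (𝓗.H η.lgn)) : 𝓗.Node :=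
  ⟨η.lgn + 1, Fin.snoc (α := fun j : Fin (η.lgn + 1) => Fin (𝓗.H j)) η.2 i⟩

/-- `η` is an initial segment of `ν`. -/
def Node.IsPrefix (η ν : 𝓗.Node) : Prop :=
  ∃ h : η.lgn ≤ ν.lgn, ∀ n (hn : n < η.lgn), η.entry n hn = ν.entry n (hn.trans_le h)

variable (𝓗)

/-- The relation symbols: `R` of arity `d + 1`, and a unary `Q η` for each `η` in the tree. -/
inductive Rel : ℕ → Type
  | R : Rel (d + 1)
  | Q (η : 𝓗.Node) : Rel 1

/-- The language of the template (equality is built in). -/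
def language : FirstOrder.Language.{0, 0} := ⟨fun _ => Empty, 𝓗.Rel⟩

/-- The symbol `R` as a relation symbol of the language. -/
def relR : 𝓗.language.Relations (d + 1) := Rel.R

/-- The symbol `Q η` as a relation symbol of the language. -/
def relQ (η : 𝓗.Node) : 𝓗.language.Relations 1 := Rel.Q η

/-- The atomic formula `R (x_{g 0}, …, x_{g d})`. -/
def atomR {n : ℕ} (g : Fin (d + 1) → Fin n) : 𝓗.language.BoundedFormula Empty n :=
  𝓗.relR.boundedFormula fun i => FirstOrder.Language.Term.var (Sum.inr (g i))

/-- The atomic formula `Q_η (x_i)`. -/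
def atomQ {n : ℕ} (η : 𝓗.Node) (i : Fin n) : 𝓗.language.BoundedFormula Empty n :=
  (𝓗.relQ η).boundedFormula fun _ => FirstOrder.Language.Term.var (Sum.inr i)

/-- The formula `x_i = x_j`. -/
def atomEq {n : ℕ} (i j : Fin n) : 𝓗.language.BoundedFormula Empty n :=
  (FirstOrder.Language.Term.var (Sum.inr i)).bdEqual (FirstOrder.Language.Term.var (Sum.inr j))

/-- The axioms of the universal theory of the template; `alls` is the universal closure. -/
inductive IsAxiom : 𝓗.language.Sentence → Prop
  /-- `R` is invariant under permutations. -/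
  | symm (σ : Equiv.Perm (Fin (d + 1))) :
      IsAxiom ((𝓗.atomR id).imp (𝓗.atomR σ)).alls
  /-- `R` holds only on tuples of distinct elements. -/
  | irrefl (i j : Fin (d + 1)) (hij : i ≠ j) :
      IsAxiom ((𝓗.atomR id).imp (𝓗.atomEq i j).not).alls
  /-- `Q` of the empty sequence names everything. -/
  | root : IsAxiom (𝓗.atomQ Node.root (0 : Fin 1)).alls
  /-- `Q ν` refines `Q η` for `η ⊴ ν`. -/
  | refine (η ν : 𝓗.Node) (h : η.IsPrefix ν) :
      IsAxiom ((𝓗.atomQ ν (0 : Fin 1)).imp (𝓗.atomQ η 0)).alls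
  /-- The predicates of the immediate successors of `η` are disjoint. -/
  | disjoint (η : 𝓗.Node) (i j : Fin (𝓗.H η.lgn)) (hij : i ≠ j) :
      IsAxiom (𝓗.atomQ (η.snoc i) (0 : Fin 1) ⊓ 𝓗.atomQ (η.snoc j) 0).not.alls
  /-- The predicates of the immediate successors of `η` cover `Q η`. -/
  | cover (η : 𝓗.Node) :
      IsAxiom ((𝓗.atomQ η (0 : Fin 1)).imp
        (FirstOrder.Language.BoundedFormula.iSup fun i : Fin (𝓗.H η.lgn) => 𝓗.atomQ (η.snoc i) 0)).alls
  /-- A non-edge of the `n`-th hypergraph forbids `R`-edges across the corresponding predicates. -/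
  | forbid (η : Fin (d + 1) → 𝓗.Node) (n : ℕ) (hn : ∀ i, n < (η i).lgn)
      (h : (fun i => (η i).entry n (hn i)) ∉ 𝓗.E n) :
      IsAxiom ((FirstOrder.Language.BoundedFormula.iInf fun i => 𝓗.atomQ (η i) i).imp (𝓗.atomR id).not).alls

/-- The universal theory of the template. -/
def universalTheory : 𝓗.language.Theory := {φ | 𝓗.IsAxiom φ}

end Template

/-! ### Model completions and saturation -/

/-- `T` is a model completion of `T₀`: every model of `T` is a model of `T₀`, every model of `T₀`
embeds into a model of `T`, and for every `M ⊨ T₀` the theory `T` together with the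
(quantifier-free) diagram of `M` is complete, that is, any two models of `T` into which `M` is
embedded satisfy the same formulas with parameters from `M`. -/
structure IsModelCompletion {L : FirstOrder.Language.{0, 0}} (T₀ T : L.Theory) : Prop where
  extends_theory : ∀ (N : Type u) [L.Structure N] [Nonempty N], N ⊨ T → N ⊨ T₀
  exists_embedding : ∀ (M : Type u) [L.Structure M] [Nonempty M], M ⊨ T₀ →
    ∃ (N : Type u) (_ : L.Structure N), N ⊨ T ∧ Nonempty (M ↪[L] N)
  complete_diagram : ∀ (M N₁ N₂ : Type u) [L.Structure M] [L.Structure N₁] [L.Structure N₂]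
    [Nonempty M], M ⊨ T₀ → N₁ ⊨ T → N₂ ⊨ T → ∀ (f₁ : M ↪[L] N₁) (f₂ : M ↪[L] N₂)
    (n : ℕ) (φ : L.Formula (Fin n)) (v : Fin n → M), φ.Realize (f₁ ∘ v) ↔ φ.Realize (f₂ ∘ v)

/-- `N` is `κ`-saturated: over every set `A` of fewer than `κ` parameters, every `1`-type `p`
(a set of formulas over `A` that is finitely satisfiable in `N`) is realized in `N`. -/
def IsSaturated (L : FirstOrder.Language.{0, 0}) (N : Type u) [L.Structure N] (κ : Cardinal.{u}) : Prop :=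
  ∀ A : Set N, Cardinal.mk A < κ → ∀ p : Set (L[[A]].Formula Unit),
    (∀ s ⊆ p, s.Finite → ∃ a : N, ∀ φ ∈ s, φ.Realize fun _ => a) →
    ∃ a : N, ∀ φ ∈ p, φ.Realize fun _ => a

/-! ### Ultrafilters -/

/-- The ultrapower `M ^ I / D`. -/
abbrev Ultrapower {I : Type u} (D : Ultrafilter I) (M : Type u) : Type u :=
  (D : Filter I).Product fun _ => M

/-- The ultrafilter `D` on `I` is regular: there is a family of `|I|` many elements of `D` such that
each point of `I` lies in only finitely many of them. -/
def Ultrafilter.IsRegular {I : Type u} (D : Ultrafilter I) : Prop :=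
  ∃ X : I → Set I, (∀ α, X α ∈ D) ∧ ∀ i, {α | i ∈ X α}.Finite

/-- The ultrafilter `D` on `I` is flexible: below any nonstandard integer `n = ⟨n i : i ∈ I⟩ / D`
there is a regularizing family of `|I|` many elements of `D`. -/
def Ultrafilter.IsFlexible {I : Type u} (D : Ultrafilter I) : Prop :=
  ∀ n : I → ℕ, (∀ m : ℕ, ∀ᶠ i in (D : Filter I), m < n i) →
    ∃ X : I → Set I, (∀ α, X α ∈ D) ∧ ∀ i, {α | i ∈ X α}.encard ≤ n i

/-- A subset of an ultrapower is internal if it is an ultraproduct of subsets `S i` of the factors. -/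
def IsInternal {I : Type u} (D : Ultrafilter I) {M : Type u} (P : Set (Ultrapower D M)) : Prop :=
  ∃ S : I → Set M, ∀ x : I → M, (x : Ultrapower D M) ∈ P ↔ ∀ᶠ i in (D : Filter I), x i ∈ S i

/-- The ultrafilter `D` on `I` is good for the random graph: in every ultrapower of an infinite set,
disjoint sets `A`, `B` with `|A| + |B| ≤ |I|` are separated by an internal set. -/
def Ultrafilter.IsGoodForRandomGraph {I : Type u} (D : Ultrafilter I) : Prop :=
  ∀ (M : Type u) [Infinite M] (A B : Set (Ultrapower D M)),
    Cardinal.mk A + Cardinal.mk B ≤ Cardinal.mk I → Disjoint A B →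
    ∃ P : Set (Ultrapower D M), IsInternal D P ∧ A ⊆ P ∧ Disjoint B P

/-! A one-type over `A ⊆ M ^ I / D` that is not realized in `A` is the type of a point `b ∉ A` in an
elementary extension. Since `T` is a model completion, it is determined by `b ∉ A`, by the branch of
`b` through the predicates `Q_η`, and by the link of `b`, the set `B` of `d`-tuples `x` from `A`
with `R (b, x)`.

To realize it when `|A| ≤ λ`, goodness for the random graph separates `B` from the other tuples
by an internal set `⟨S i⟩ / D`. For each tuple in `B` and each standard `m`, the first `m`
hypergraphs of the template allow, in almost all factors, an edge between that tuple and a point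
on the branch of `b`; goodness again yields a nonstandard `n` such that this remains so up to
level `n i`. As the growth function `f` tends to infinity, there is a nonstandard `r` with
`r i ^ d ≤ f k` for `n i ≤ k`, and flexibility covers `A` by finite sets `F i` of at most `r i`
points. In the factor `i` the branch of `b` is kept below `n i`, and from there on the extension
property of the template changes it into one that allows all the edges to `d`-tuples from `F i`.
A point on this new branch with the link prescribed by `S i` on `F i` can be added to `M`, and
since `T` is a model completion there is such a point, up to level `n i`, in `M` itself. -/

section ModelCompletion

open FirstOrder.Language

variable {L : FirstOrder.Language.{0, 0}} {T₀ T : L.Theory}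

theorem IsModelCompletion.realize_comp_iff {α : Type*} {M N₁ N₂ : Type u} [L.Structure M]
    [L.Structure N₁] [L.Structure N₂] [Nonempty M] (hT : IsModelCompletion.{u} T₀ T)
    (hM : M ⊨ T₀) (h₁ : N₁ ⊨ T) (h₂ : N₂ ⊨ T) (f₁ : M ↪[L] N₁) (f₂ : M ↪[L] N₂)
    (φ : L.Formula α) (v : α → M) :
    φ.Realize (f₁ ∘ v) ↔ φ.Realize (f₂ ∘ v) := by
  classical
  let e := φ.freeVarFinset.equivFin
  have realize_restrict {N : Type u} [L.Structure N] (f : M → N) :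
      (φ.restrictFreeVar e).Realize (f ∘ fun i => v (e.symm i)) (default : Fin 0 → N) ↔
        φ.Realize (f ∘ v) :=
    BoundedFormula.realize_restrictFreeVar (f ∘ v) fun a => by simp
  rw [← realize_restrict, ← realize_restrict]
  exact hT.complete_diagram M N₁ N₂ hM h₁ h₂ f₁ f₂ _ _ _

end ModelCompletion

namespace Ultrapower

open FirstOrder.Language Filter

variable {I M : Type u} {D : Ultrafilter I}

/-- The class of a sequence in the ultrapower. -/
def mk (D : Ultrafilter I) (x : I → M) : Ultrapower D M := (x : Ultrapower D M)

theorem mk_surjective : Function.Surjective (mk D : (I → M) → Ultrapower D M) :=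
  Quotient.exists_rep

theorem mk_eq_mk {x y : I → M} : mk D x = mk D y ↔ ∀ᶠ i in (D : Filter I), x i = y i :=
  Quotient.eq''

theorem eventually_injective {ι : Type*} [Finite ι] {x : ι → I → M}
    (hx : Function.Injective fun k => mk D (x k)) :
    ∀ᶠ i in (D : Filter I), Function.Injective fun k => x k i := by
  refine eventually_all.2 fun k => eventually_all.2 fun l => ?_
  rw [Ultrafilter.eventually_imp]
  exact fun h => Eventually.of_forall fun _ => hx (mk_eq_mk.2 h)

section Realize

variable {L : FirstOrder.Language} [L.Structure M]

theorem relMap_mk {n : ℕ} (r : L.Relations n) (x : Fin n → I → M) :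
    (Structure.RelMap r fun j => mk D (x j)) ↔
      ∀ᶠ i in (D : Filter I), Structure.RelMap r fun j => x j i :=
  relMap_quotient_mk' (s := (D : Filter I).productSetoid fun _ => M)
    (ps := Ultraproduct.setoidPrestructure (fun _ => M) D) r x

variable [Nonempty M]

theorem realize_mk {α : Type*} (φ : L.Formula α) (x : α → I → M) :
    (φ.Realize fun a => mk D (x a)) ↔ ∀ᶠ i in (D : Filter I), φ.Realize fun a => x a i :=
  Ultraproduct.realize_formula_cast φ x

theorem model {T : L.Theory} (hM : M ⊨ T) : Ultrapower D M ⊨ T :=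
  ⟨fun φ hφ => (Ultraproduct.sentence_realize φ).2 (Eventually.of_forall fun _ =>
    hM.realize_of_mem φ hφ)⟩

/-- The elementary embedding of a structure into its ultrapower by constant sequences. -/
def diagonal (D : Ultrafilter I) (M : Type u) [L.Structure M] [Nonempty M] :
    M ↪ₑ[L] Ultrapower D M where
  toFun a := mk D fun _ => a
  map_formula' _ φ x := (realize_mk φ fun j _ => x j).trans eventually_const

end Realize

end Ultrapower

section Saturation

open FirstOrder.Language Filter

variable {L : FirstOrder.Language.{0, 0}} {N : Type u} [L.Structure N] [Nonempty N]

theorem exists_elementaryEmbedding_forall_realize {A : Set N} {p : Set (L[[A]].Formula Unit)}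
    (hp : ∀ s ⊆ p, s.Finite → ∃ a : N, ∀ φ ∈ s, φ.Realize fun _ => a) :
    ∃ (N' : Type u) (_ : L.Structure N') (j : N ↪ₑ[L] N') (b : N'), ∀ φ ∈ p,
      Formula.Realize (BoundedFormula.constantsVarsEquiv φ)
        (Sum.elim (fun a : A => j a) fun _ => b) := by
  have exists_realize (s : Finset p) : ∃ a : N, ∀ φ ∈ s, φ.1.Realize fun _ => a := by
    obtain ⟨a, ha⟩ := hp (Subtype.val '' (s : Set p)) (by simp) (s.finite_toSet.image _)
    exact ⟨a, fun φ hφ => ha _ ⟨φ, hφ, rfl⟩⟩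
  choose b hb using exists_realize
  let U : Ultrafilter (Finset p) := Ultrafilter.of atTop
  refine ⟨_, inferInstance, Ultrapower.diagonal U N, Ultrapower.mk U b, fun φ hφ => ?_⟩
  have elim_eq : (Sum.elim (fun a : A => Ultrapower.diagonal (L := L) U N a)
      fun _ : Unit => Ultrapower.mk U b) =
      fun k => Ultrapower.mk U (Sum.elim (fun (a : A) _ => (a : N)) (fun _ => b) k) := by
    funext k
    cases k <;> rfl
  have eventually_mem : ∀ᶠ s in (U : Filter (Finset p)), {⟨φ, hφ⟩} ≤ s :=
    Ultrafilter.of_le atTop (eventually_ge_atTop _)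
  rw [elim_eq, Ultrapower.realize_mk]
  filter_upwards [eventually_mem] with s hs
  have realize_at : Formula.Realize (BoundedFormula.constantsVarsEquiv φ)
      (Sum.elim (fun a : A => (a : N)) fun _ => b s) :=
    BoundedFormula.realize_constantsVarsEquiv.2 (hb s ⟨φ, hφ⟩ (Finset.singleton_subset_iff.1 hs))
  convert! realize_at using 1
  funext k
  cases k <;> rfl

theorem isSaturated_of_forall_elementaryEmbedding {κ : Cardinal.{u}}
    (h : ∀ (N' : Type u) [L.Structure N'] (j : N ↪ₑ[L] N') (b : N'), b ∉ Set.range j →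
      ∀ A : Set N, Cardinal.mk A < κ → ∃ c : N, ∀ φ : L.Formula (A ⊕ Unit),
        φ.Realize (Sum.elim (fun a => j a) fun _ => b) →
          φ.Realize (Sum.elim (fun a => (a : N)) fun _ => c)) :
    IsSaturated L N κ := by
  intro A hA p hp
  obtain ⟨N', _, j, b, hb⟩ := exists_elementaryEmbedding_forall_realize hp
  suffices ∃ c : N, ∀ φ : L.Formula (A ⊕ Unit), φ.Realize (Sum.elim (fun a => j a) fun _ => b) →
      φ.Realize (Sum.elim (fun a => (a : N)) fun _ => c) by
    obtain ⟨c, hc⟩ := this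
    exact ⟨c, fun φ hφ => BoundedFormula.realize_constantsVarsEquiv.1 (hc _ (hb φ hφ))⟩
  by_cases hbj : b ∈ Set.range j
  · obtain ⟨a, rfl⟩ := hbj
    refine ⟨a, fun φ hφ => (j.map_formula φ _).1 ?_⟩
    rwa [Sum.comp_elim]
  · exact h N' j b hbj A hA

end Saturation

/-! ### Internal sets and nonstandard integers -/

namespace Ultrapower

open Filter Cardinal

variable {I : Type u} {D : Ultrafilter I}

theorem exists_tendsto_atTop_of_isRegular [Infinite I] (hD : D.IsRegular) :
    ∃ h : I → ℕ, Tendsto h D atTop := by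
  obtain ⟨X, hX, hfin⟩ := hD
  refine ⟨fun i => {α | i ∈ X α}.ncard, tendsto_atTop.2 fun m => ?_⟩
  obtain ⟨s, rfl⟩ := Infinite.exists_subset_card_eq I m
  filter_upwards [(eventually_all_finset s).2 fun α _ => hX α] with i hi
  rw [← Set.ncard_coe_finset]
  exact Set.ncard_le_ncard (fun α hα => hi α hα) (hfin i)

theorem exists_internal_separation [Infinite I] (hD : D.IsGoodForRandomGraph) {X κ : Type u}
    [Infinite X] (hκ : #κ ≤ #I) {x : κ → I → X} {B : Set κ}
    (hx : ∀ k ∈ B, ∀ l ∉ B, mk D (x k) ≠ mk D (x l)) :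
    ∃ S : I → Set X, (∀ k ∈ B, ∀ᶠ i in (D : Filter I), x k i ∈ S i) ∧
      ∀ k ∉ B, ∀ᶠ i in (D : Filter I), x k i ∉ S i := by
  let q : κ → Ultrapower D X := fun k => mk D (x k)
  have card_image_le (s : Set κ) : #(q '' s) ≤ #I :=
    (mk_image_le.trans (mk_set_le s)).trans hκ
  have disjoint_image : Disjoint (q '' B) (q '' Bᶜ) := by
    rw [Set.disjoint_left]
    rintro _ ⟨k, hk, rfl⟩ ⟨l, hl, h⟩
    exact hx k hk l hl h.symm
  obtain ⟨P, ⟨S, hS⟩, hBP, hP⟩ := hD X (q '' B) (q '' Bᶜ)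
    ((add_le_add (card_image_le B) (card_image_le Bᶜ)).trans (add_eq_self (aleph0_le_mk I)).le)
    disjoint_image
  refine ⟨S, fun k hk => (hS _).1 (hBP ⟨k, hk, rfl⟩), fun k hk => ?_⟩
  rw [Ultrafilter.eventually_not]
  exact fun h => Set.disjoint_left.1 hP ⟨k, hk, rfl⟩ ((hS _).2 h)

theorem exists_tendsto_atTop_le [Infinite I] (hD : D.IsGoodForRandomGraph) {κ : Type u}
    [Nonempty κ] (hκ : #κ ≤ #I) {g : κ → I → ℕ} (hg : ∀ k, Tendsto (g k) D atTop) :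
    ∃ n : I → ℕ, Tendsto n D atTop ∧ ∀ k, ∀ᶠ i in (D : Filter I), n i ≤ g k i := by
  let x : ULift.{u} ℕ ⊕ κ → I → ULift.{u} ℕ := Sum.elim (fun m _ => m) fun k i => ⟨g k i⟩
  have card_le : #(ULift.{u} ℕ ⊕ κ) ≤ #I := by
    rw [mk_sum, lift_id, lift_id]
    exact add_le_of_le (aleph0_le_mk I) (mk_le_aleph0.trans (aleph0_le_mk I)) hκ
  have mk_ne : ∀ m ∈ Set.range Sum.inl, ∀ k ∉ Set.range Sum.inl, mk D (x m) ≠ mk D (x k) := by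
    rintro _ ⟨⟨m⟩, rfl⟩ (l | k) hk h
    · exact hk ⟨l, rfl⟩
    · obtain ⟨i, hi, hlt⟩ := ((mk_eq_mk.1 h).and ((hg k).eventually_gt_atTop m)).exists
      exact hlt.ne (congrArg ULift.down hi)
  obtain ⟨S, hS, hgS⟩ := exists_internal_separation hD card_le mk_ne
  replace hgS (k : κ) : ∀ᶠ i in (D : Filter I), ULift.up (g k i) ∉ S i := hgS (Sum.inr k) (by simp)
  -- `S` contains the standard integers and omits every `g k`: take its least omitted integer.
  refine ⟨fun i => sInf {n | ULift.up n ∉ S i}, tendsto_atTop.2 fun m => ?_, fun k => ?_⟩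
  · have eventually_mem : ∀ᶠ i in (D : Filter I), ∀ n ∈ Finset.range m, ULift.up n ∈ S i :=
      (eventually_all_finset _).2 fun n _ => hS (Sum.inl ⟨n⟩) ⟨_, rfl⟩
    filter_upwards [eventually_mem, hgS (Classical.arbitrary κ)] with i hi hne
    by_contra! hlt
    exact Nat.sInf_mem (s := {n | ULift.up n ∉ S i}) ⟨_, hne⟩ (hi _ (Finset.mem_range.2 hlt))
  · filter_upwards [hgS k] with i hi
    exact Nat.sInf_le hi

theorem overspill [Infinite I] (hreg : D.IsRegular) (hrg : D.IsGoodForRandomGraph) {κ : Type u}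
    (hκ : #κ ≤ #I) {p : κ → I → ℕ → Prop} (hp : ∀ k m, ∀ᶠ i in (D : Filter I), p k i m) :
    ∃ n : I → ℕ, Tendsto n D atTop ∧ ∀ k, ∀ᶠ i in (D : Filter I), ∀ m < n i, p k i m := by
  classical
  obtain ⟨h, hh⟩ := exists_tendsto_atTop_of_isRegular hreg
  rcases isEmpty_or_nonempty κ with _ | _
  · exact ⟨h, hh, isEmptyElim⟩
  let g (k : κ) (i : I) : ℕ := Nat.findGreatest (fun n => ∀ m < n, p k i m) (h i)
  have tendsto_g (k : κ) : Tendsto (g k) D atTop := tendsto_atTop.2 fun n => by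
    have eventually_p : ∀ᶠ i in (D : Filter I), ∀ m ∈ Finset.range n, p k i m :=
      (eventually_all_finset _).2 fun m _ => hp k m
    filter_upwards [eventually_p, hh.eventually_ge_atTop n] with i hi hn
    exact Nat.le_findGreatest hn fun m hm => hi m (Finset.mem_range.2 hm)
  obtain ⟨n, hn, hng⟩ := exists_tendsto_atTop_le hrg hκ tendsto_g
  refine ⟨n, hn, fun k => (hng k).mono fun i hi m hm => ?_⟩
  exact Nat.findGreatest_spec (P := fun n => ∀ m < n, p k i m) (Nat.zero_le (h i))
    (fun m hm => absurd hm (Nat.not_lt_zero m)) m (hm.trans_le hi)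

theorem exists_finset_of_isFlexible (hD : D.IsFlexible) {κ : Type u} (hκ : #κ ≤ #I) {M : Type*}
    (x : κ → I → M) {r : I → ℕ} (hr : Tendsto r D atTop) :
    ∃ F : I → Finset M, (∀ i, (F i).card ≤ r i) ∧ ∀ k, ∀ᶠ i in (D : Filter I), x k i ∈ F i := by
  classical
  obtain ⟨X, hX, hXr⟩ := hD r hr.eventually_gt_atTop
  obtain ⟨e⟩ : Nonempty (κ ↪ I) := hκ
  have encard_le (i : I) : {k | i ∈ X (e k)}.encard ≤ r i :=
    (Set.encard_le_encard_of_injOn (Set.mapsTo_preimage e _) e.injective.injOn).trans (hXr i)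
  have finite (i : I) : {k | i ∈ X (e k)}.Finite := Set.finite_of_encard_le_coe (encard_le i)
  refine ⟨fun i => (finite i).toFinset.image (x · i), fun i => ?_, fun k => ?_⟩
  · refine Finset.card_image_le.trans ?_
    have := encard_le i
    rw [(finite i).encard_eq_coe_toFinset_card] at this
    exact_mod_cast this
  · filter_upwards [hX (e k)] with i hi
    exact Finset.mem_image_of_mem _ ((finite i).mem_toFinset.2 hi)

end Ultrapower

theorem exists_tendsto_atTop_pow_le {f : ℕ → ℕ} (hf : Filter.Tendsto f Filter.atTop Filter.atTop)
    {d : ℕ} (hd : d ≠ 0) :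
    ∃ r : ℕ → ℕ, Filter.Tendsto r Filter.atTop Filter.atTop ∧ ∀ n k, n ≤ k → r n ^ d ≤ f k := by
  classical
  let p (n m : ℕ) : Prop := ∀ k, n ≤ k → m ^ d ≤ f k
  refine ⟨fun n => Nat.findGreatest (p n) n, Filter.tendsto_atTop.2 fun m => ?_, fun n => ?_⟩
  · obtain ⟨N, hN⟩ := Filter.eventually_atTop.1 (hf.eventually_ge_atTop (m ^ d))
    filter_upwards [Filter.eventually_ge_atTop m, Filter.eventually_ge_atTop N] with n hm hn
    exact Nat.le_findGreatest hm fun k hk => hN k (hn.trans hk)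
  · refine Nat.findGreatest_spec (P := p n) (Nat.zero_le n) fun k _ => ?_
    simp only [zero_pow hd, Nat.zero_le]

/-! ### Branches -/

theorem IsFullHypergraph.comp_perm_mem {V : Type*} {k : ℕ} {E : Set (Fin k → V)}
    (hE : IsFullHypergraph E) {x : Fin k → V} (hx : x ∈ E) (σ : Equiv.Perm (Fin k)) :
    x ∘ σ ∈ E := by
  obtain ⟨E', -, hsymm, rfl⟩ := hE
  rcases hx with hx | hx
  · exact Or.inl (hsymm x hx σ)
  · exact Or.inr fun h => hx ((σ.injective_comp x).1 h)

theorem IsGrowthFunction.exists_common_neighbour {d : ℕ} {H : ℕ → ℕ}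
    {E : ∀ n, Set (Fin (d + 1) → Fin (H n))} {f : ℕ → ℕ} (hf : IsGrowthFunction H E f) {V : Type*}
    (F : Finset V) {n : ℕ} (hF : F.card ^ d ≤ f n) (p : V → Fin (H n)) :
    ∃ s : Fin (H n), ∀ x : Fin d → V, (∀ l, x l ∈ F) →
      (Fin.cons s (p ∘ x) : Fin (d + 1) → Fin (H n)) ∈ E n := by
  classical
  rcases isEmpty_or_nonempty (Fin d → F) with hempty | _
  · exact ⟨⟨0, (hf.pos n).trans_le (hf.le_card n)⟩, fun x hx => hempty.elim fun l => ⟨x l, hx l⟩⟩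
  · have card_le : Fintype.card (Fin d → F) ≤ Fintype.card (Fin (f n)) := by simpa using hF
    obtain ⟨e⟩ := Function.Embedding.nonempty_of_card_le card_le
    obtain ⟨s, hs⟩ := hf.extension n fun j l => p (Function.invFun e j l)
    refine ⟨s, fun x hx => ?_⟩
    have := hs (e fun l => ⟨x l, hx l⟩)
    rwa [Function.leftInverse_invFun e.injective] at this

namespace Template

open FirstOrder.Language Structure

section Tuples

variable {d : ℕ} {V : Type*}

theorem cons_comp_decomposeFin_symm (c : V) (x : Fin d → V) (σ : Equiv.Perm (Fin d)) :
    (Fin.cons c x : Fin (d + 1) → V) ∘ Equiv.Perm.decomposeFin.symm (0, σ) =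
      Fin.cons c (x ∘ σ) := by
  funext i
  cases i using Fin.cases <;> simp

theorem eq_inl_comp_or_comp_perm_eq_cons {y : Fin (d + 1) → V ⊕ Unit} (hy : Function.Injective y) :
    (∃ x : Fin (d + 1) → V, y = Sum.inl ∘ x) ∨
      ∃ (σ : Equiv.Perm (Fin (d + 1))) (x : Fin d → V),
        y ∘ σ = Fin.cons (Sum.inr ()) (Sum.inl ∘ x) := by
  by_cases h : ∃ i, y i = Sum.inr ()
  · obtain ⟨i, hi⟩ := h
    have isLeft_succ (l : Fin d) : ∃ a, (y ∘ Equiv.swap 0 i) l.succ = Sum.inl a := by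
      rcases hl : (y ∘ Equiv.swap 0 i) l.succ with a | _
      · exact ⟨a, rfl⟩
      · have := hy.comp (Equiv.swap 0 i).injective (hl.trans (by simpa using hi.symm) :
          _ = (y ∘ Equiv.swap 0 i) 0)
        exact absurd this (Fin.succ_ne_zero l)
    choose x hx using isLeft_succ
    refine Or.inr ⟨Equiv.swap 0 i, x, funext fun l => ?_⟩
    cases l using Fin.cases with
    | zero => simpa using hi
    | succ l => exact hx l
  · have isLeft (i : Fin (d + 1)) : ∃ a, y i = Sum.inl a := by
      rcases hi : y i with a | _
      · exact ⟨a, rfl⟩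
      · exact absurd ⟨i, hi⟩ h
    choose x hx using isLeft
    exact Or.inl ⟨x, funext hx⟩

end Tuples

variable {d : ℕ} {𝓗 : Template d}

section Branches

namespace Node

theorem entry_snoc_lgn (η : 𝓗.Node) (i : Fin (𝓗.H η.lgn)) :
    (η.snoc i).entry η.lgn (Nat.lt_succ_self _) = i :=
  Fin.snoc_last (α := fun j : Fin (η.lgn + 1) => Fin (𝓗.H j)) i η.2

theorem entry_snoc_of_lt (η : 𝓗.Node) (i : Fin (𝓗.H η.lgn)) {n : ℕ} (hn : n < η.lgn) :
    (η.snoc i).entry n (Nat.lt_succ_of_lt hn) = η.entry n hn :=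
  Fin.snoc_castSucc (α := fun j : Fin (η.lgn + 1) => Fin (𝓗.H j)) i η.2 ⟨n, hn⟩

theorem IsPrefix.snoc {μ η : 𝓗.Node} (h : μ.IsPrefix η) (hlt : μ.lgn < η.lgn) :
    (μ.snoc (η.entry μ.lgn hlt)).IsPrefix η := by
  refine ⟨hlt, fun n hn => ?_⟩
  rcases Nat.lt_succ_iff_lt_or_eq.1 hn with hn | rfl
  · exact (μ.entry_snoc_of_lt _ hn).trans (h.2 n hn)
  · exact μ.entry_snoc_lgn _

end Node

/-- The predicate `Q_η` holds of `a`. -/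
def Lies {M : Type*} [𝓗.language.Structure M] (η : 𝓗.Node) (a : M) : Prop :=
  RelMap (𝓗.relQ η) fun _ : Fin 1 => a

/-- The set of tuples at which `R` holds. -/
def edges (𝓗 : Template d) (M : Type*) [𝓗.language.Structure M] : Set (Fin (d + 1) → M) :=
  {x | RelMap 𝓗.relR x}

/-- `R` is a symmetric irreflexive hypergraph which the coordinate maps `π n` send into the `n`-th
hypergraph of the template, for every `n`: this is what the universal theory requires of the
relation `R` if the point `a` lies on the infinite branch `fun n => π n a`. -/
structure IsEdgeSet {V : Type*} (π : ∀ n, V → Fin (𝓗.H n)) (R : Set (Fin (d + 1) → V)) :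
    Prop where
  symm : ∀ x ∈ R, ∀ σ : Equiv.Perm (Fin (d + 1)), x ∘ σ ∈ R
  injective : ∀ x ∈ R, Function.Injective x
  mem_edges : ∀ x ∈ R, ∀ n, π n ∘ x ∈ 𝓗.E n

theorem IsEdgeSet.comp_perm_mem_iff {V : Type*} {π : ∀ n, V → Fin (𝓗.H n)}
    {R : Set (Fin (d + 1) → V)} (hR : IsEdgeSet π R) {x : Fin (d + 1) → V}
    (σ : Equiv.Perm (Fin (d + 1))) : x ∘ σ ∈ R ↔ x ∈ R := by
  refine ⟨fun hx => ?_, fun hx => hR.symm x hx σ⟩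
  simpa only [Function.comp_assoc, Equiv.self_comp_symm, Function.comp_id] using
    hR.symm _ hx σ.symm

theorem IsEdgeSet.comap {V W : Type*} {π : ∀ n, V → Fin (𝓗.H n)} {R : Set (Fin (d + 1) → V)}
    (hR : IsEdgeSet π R) (f : W → V) : IsEdgeSet (fun n => π n ∘ f) {y | f ∘ y ∈ R} where
  symm _ hy σ := hR.symm _ hy σ
  injective _ hy := (hR.injective _ hy).of_comp
  mem_edges _ hy n := hR.mem_edges _ hy n

/-- `π` assigns to each point of a model of the universal theory the infinite branch on which it
lies, coordinate by coordinate. -/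
structure IsBranchMap {M : Type*} [𝓗.language.Structure M] (π : ∀ n, M → Fin (𝓗.H n)) :
    Prop where
  lies_iff : ∀ (η : 𝓗.Node) (a : M), Lies η a ↔ ∀ n hn, η.entry n hn = π n a
  isEdgeSet : IsEdgeSet π (𝓗.edges M)

section

variable {M : Type*} [𝓗.language.Structure M] {π : ∀ n, M → Fin (𝓗.H n)}

theorem IsBranchMap.lies_snoc_iff (hπ : IsBranchMap π) (η : 𝓗.Node) (i : Fin (𝓗.H η.lgn))
    (a : M) : Lies (η.snoc i) a ↔ Lies η a ∧ i = π η.lgn a := by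
  rw [hπ.lies_iff, hπ.lies_iff]
  refine ⟨fun h => ⟨fun n hn => ?_, ?_⟩, fun ⟨hη, hi⟩ n hn => ?_⟩
  · exact (η.entry_snoc_of_lt i hn).symm.trans (h n _)
  · exact (η.entry_snoc_lgn i).symm.trans (h η.lgn _)
  · rcases Nat.lt_succ_iff_lt_or_eq.1 hn with hn | rfl
    · exact (η.entry_snoc_of_lt i hn).trans (hη n hn)
    · exact (η.entry_snoc_lgn i).trans hi

theorem IsBranchMap.model (hπ : IsBranchMap π) : M ⊨ 𝓗.universalTheory := by
  refine ⟨fun φ hφ => ?_⟩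
  cases hφ <;> refine BoundedFormula.realize_alls.2 fun x => ?_
  case symm σ => exact fun hx => hπ.isEdgeSet.symm x hx σ
  case irrefl i j hij => exact fun hx heq => hij (hπ.isEdgeSet.injective x hx heq)
  case root => exact (hπ.lies_iff Node.root (x 0)).2 fun n hn => absurd hn n.not_lt_zero
  case refine η ν h =>
    exact fun hν => (hπ.lies_iff η (x 0)).2 fun n hn =>
      (h.2 n hn).trans ((hπ.lies_iff ν (x 0)).1 hν n _)
  case disjoint η i j hij =>
    rw [BoundedFormula.realize_not, BoundedFormula.realize_inf]
    exact fun ⟨hi, hj⟩ => hij <| ((hπ.lies_snoc_iff η i (x 0)).1 hi).2.trans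
      ((hπ.lies_snoc_iff η j (x 0)).1 hj).2.symm
  case cover η =>
    rw [BoundedFormula.realize_imp, BoundedFormula.realize_iSup]
    exact fun hη => ⟨π η.lgn (x 0), (hπ.lies_snoc_iff η _ (x 0)).2 ⟨hη, rfl⟩⟩
  case forbid η n hn hE =>
    rw [BoundedFormula.realize_imp, BoundedFormula.realize_iInf]
    refine fun hη hx => hE ?_
    rw [show (fun i => (η i).entry n (hn i)) = π n ∘ x from
      funext fun i => (hπ.lies_iff (η i) (x i)).1 (hη i) n (hn i)]
    exact hπ.isEdgeSet.mem_edges x hx n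

theorem lies_root (hM : M ⊨ 𝓗.universalTheory) (a : M) : Lies (𝓗 := 𝓗) Node.root a :=
  BoundedFormula.realize_alls.1 (hM.realize_of_mem _ IsAxiom.root) fun _ => a

theorem Lies.of_isPrefix (hM : M ⊨ 𝓗.universalTheory) {η ν : 𝓗.Node} {a : M} (hν : Lies ν a)
    (h : η.IsPrefix ν) : Lies η a :=
  BoundedFormula.realize_alls.1 (hM.realize_of_mem _ (IsAxiom.refine η ν h)) (fun _ => a) hν

theorem Lies.eq_of_snoc (hM : M ⊨ 𝓗.universalTheory) {η : 𝓗.Node} {i j : Fin (𝓗.H η.lgn)} {a : M}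
    (hi : Lies (η.snoc i) a) (hj : Lies (η.snoc j) a) : i = j := by
  by_contra hij
  have := BoundedFormula.realize_alls.1 (hM.realize_of_mem _ (IsAxiom.disjoint η i j hij))
    fun _ => a
  rw [BoundedFormula.realize_not, BoundedFormula.realize_inf] at this
  exact this ⟨hi, hj⟩

theorem Lies.exists_snoc (hM : M ⊨ 𝓗.universalTheory) {η : 𝓗.Node} {a : M} (hη : Lies η a) :
    ∃ i, Lies (η.snoc i) a := by
  have := BoundedFormula.realize_alls.1 (hM.realize_of_mem _ (IsAxiom.cover η)) fun _ => a
  rw [BoundedFormula.realize_imp, BoundedFormula.realize_iSup] at this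
  exact this hη

theorem Lies.entry_eq (hM : M ⊨ 𝓗.universalTheory) {η ν : 𝓗.Node} {a : M} (hη : Lies η a)
    (hν : Lies ν a) {n : ℕ} (hnη : n < η.lgn) (hnν : n < ν.lgn) :
    η.entry n hnη = ν.entry n hnν := by
  induction n using Nat.strong_induction_on with | _ n ih
  let μ : 𝓗.Node := ⟨n, fun i => η.entry i (i.2.trans hnη)⟩
  have prefix_η : μ.IsPrefix η := ⟨hnη.le, fun _ _ => rfl⟩
  have prefix_ν : μ.IsPrefix ν := ⟨hnν.le, fun k hk => ih k hk _ _⟩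
  exact Lies.eq_of_snoc hM (hη.of_isPrefix hM (prefix_η.snoc hnη))
    (hν.of_isPrefix hM (prefix_ν.snoc hnν))

theorem exists_lies_of_lgn (hM : M ⊨ 𝓗.universalTheory) (m : ℕ) (a : M) :
    ∃ x : (i : Fin m) → Fin (𝓗.H i), Lies (⟨m, x⟩ : 𝓗.Node) a := by
  induction m with
  | zero => exact ⟨_, lies_root hM a⟩
  | succ m ih =>
    obtain ⟨x, hx⟩ := ih
    obtain ⟨i, hi⟩ := hx.exists_snoc hM
    exact ⟨_, hi⟩

theorem not_mem_edges_of_lies (hM : M ⊨ 𝓗.universalTheory) {η : Fin (d + 1) → 𝓗.Node}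
    {x : Fin (d + 1) → M} (hη : ∀ i, Lies (η i) (x i)) {n : ℕ} (hn : ∀ i, n < (η i).lgn)
    (h : (fun i => (η i).entry n (hn i)) ∉ 𝓗.E n) : x ∉ 𝓗.edges M := by
  have := BoundedFormula.realize_alls.1 (hM.realize_of_mem _ (IsAxiom.forbid η n hn h)) x
  rw [BoundedFormula.realize_imp, BoundedFormula.realize_iInf] at this
  exact this hη

theorem exists_isBranchMap (hM : M ⊨ 𝓗.universalTheory) :
    ∃ π : ∀ n, M → Fin (𝓗.H n), IsBranchMap π := by
  choose x hx using exists_lies_of_lgn hM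
  have entry_eq {η : 𝓗.Node} {a : M} (hη : Lies η a) (n : ℕ) (hn : n < η.lgn) :
      η.entry n hn = x (n + 1) a (Fin.last n) :=
    hη.entry_eq hM (hx (n + 1) a) hn (Nat.lt_succ_self n)
  refine ⟨fun n a => x (n + 1) a (Fin.last n), fun η a => ⟨entry_eq, fun h => ?_⟩,
    fun y hy σ => ?_, fun y hy i j hij => ?_, fun y hy n => ?_⟩
  · obtain ⟨m, y⟩ := η
    rw [show y = x m a from funext fun n => (h n n.2).trans (entry_eq (hx m a) n n.2).symm]
    exact hx m a
  · exact BoundedFormula.realize_alls.1 (hM.realize_of_mem _ (IsAxiom.symm σ)) y hy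
  · by_contra hne
    exact BoundedFormula.realize_alls.1 (hM.realize_of_mem _ (IsAxiom.irrefl i j hne)) y hy hij
  · by_contra hE
    exact not_mem_edges_of_lies hM (fun i => hx (n + 1) (y i)) (fun _ => Nat.lt_succ_self n) hE hy

end

end Branches

/-! ### Links -/

section Links

variable {V W : Type*} {π : ∀ n, V → Fin (𝓗.H n)} {ρ : ∀ n, Fin (𝓗.H n)}

/-- `P` may serve as the link `{x | R (c, x)}` of a new point `c` on the branch `ρ`, as far as the
hypergraphs of the template with index in `s` are concerned. -/
structure IsLink (π : ∀ n, V → Fin (𝓗.H n)) (ρ : ∀ n, Fin (𝓗.H n)) (s : Set ℕ)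
    (P : Set (Fin d → V)) : Prop where
  symm : ∀ x ∈ P, ∀ σ : Equiv.Perm (Fin d), x ∘ σ ∈ P
  injective : ∀ x ∈ P, Function.Injective x
  cons_mem : ∀ x ∈ P, ∀ n ∈ s, (Fin.cons (ρ n) (π n ∘ x) : Fin (d + 1) → Fin (𝓗.H n)) ∈ 𝓗.E n

theorem IsEdgeSet.isLink {R : Set (Fin (d + 1) → V)} (hR : IsEdgeSet π R) (v : W → V) (c : V) :
    IsLink (fun n => π n ∘ v) (fun n => π n c) Set.univ {x | Fin.cons c (v ∘ x) ∈ R} where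
  symm x hx σ := by
    have := hR.symm _ hx (Equiv.Perm.decomposeFin.symm (0, σ))
    rwa [cons_comp_decomposeFin_symm] at this
  injective x hx := (Fin.cons_injective_iff.1 (hR.injective _ hx)).2.of_comp
  cons_mem x hx n _ := by
    have := hR.mem_edges _ hx n
    rwa [Fin.comp_cons] at this

/-- The largest link `P` on the branch `ρ` that is contained in `S`, where only the hypergraphs of
the template with index in `s` are taken into account. -/
def linkInside (π : ∀ n, V → Fin (𝓗.H n)) (ρ : ∀ n, Fin (𝓗.H n)) (s : Set ℕ)
    (S : Set (Fin d → V)) : Set (Fin d → V) :=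
  {x | (∀ σ : Equiv.Perm (Fin d), x ∘ σ ∈ S) ∧ Function.Injective x ∧
    ∀ n ∈ s, (Fin.cons (ρ n) (π n ∘ x) : Fin (d + 1) → Fin (𝓗.H n)) ∈ 𝓗.E n}

theorem isLink_linkInside (π : ∀ n, V → Fin (𝓗.H n)) (ρ : ∀ n, Fin (𝓗.H n)) (s : Set ℕ)
    (S : Set (Fin d → V)) : IsLink π ρ s (linkInside π ρ s S) where
  symm x hx σ := by
    refine ⟨fun τ => hx.1 (τ.trans σ), hx.2.1.comp σ.injective, fun n hn => ?_⟩
    have := (𝓗.full n).comp_perm_mem (hx.2.2 n hn) (Equiv.Perm.decomposeFin.symm (0, σ))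
    rwa [cons_comp_decomposeFin_symm] at this
  injective _ hx := hx.2.1
  cons_mem _ hx := hx.2.2

theorem IsLink.exists_isLink_univ {f : ℕ → ℕ} (hf : IsGrowthFunction 𝓗.H 𝓗.E f) {m : ℕ}
    {P : Set (Fin d → V)} (hP : IsLink π ρ (Set.Iio m) P) (F : Finset V)
    (hF : ∀ n, m ≤ n → F.card ^ d ≤ f n) :
    ∃ ρ' : ∀ n, Fin (𝓗.H n), (∀ n < m, ρ' n = ρ n) ∧
      IsLink π ρ' Set.univ {x ∈ P | ∀ l, x l ∈ F} := by
  have exists_entry (n : ℕ) : ∃ s : Fin (𝓗.H n), (n < m → s = ρ n) ∧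
      ∀ x ∈ P, (∀ l, x l ∈ F) →
        (Fin.cons s (π n ∘ x) : Fin (d + 1) → Fin (𝓗.H n)) ∈ 𝓗.E n := by
    rcases lt_or_ge n m with h | h
    · exact ⟨ρ n, fun _ => rfl, fun x hx _ => hP.cons_mem x hx n h⟩
    · obtain ⟨s, hs⟩ := hf.exists_common_neighbour F (hF n h) (π n)
      exact ⟨s, fun h' => absurd h' h.not_gt, fun x _ => hs x⟩
  choose ρ' hρ' hmem using exists_entry
  exact ⟨ρ', hρ', fun x hx σ => ⟨hP.symm x hx.1 σ, fun l => hx.2 (σ l)⟩,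
    fun x hx => hP.injective x hx.1, fun x hx n _ => hmem n x hx.1 hx.2⟩

/-- The hypergraph `R` on `V` with a further point, the link of which is `P`. -/
def pointExtension (R : Set (Fin (d + 1) → V)) (P : Set (Fin d → V)) :
    Set (Fin (d + 1) → V ⊕ Unit) :=
  {y | (∃ x ∈ R, y = Sum.inl ∘ x) ∨
    ∃ σ : Equiv.Perm (Fin (d + 1)), ∃ x ∈ P, y ∘ σ = Fin.cons (Sum.inr ()) (Sum.inl ∘ x)}

theorem inl_comp_mem_pointExtension {R : Set (Fin (d + 1) → V)} {P : Set (Fin d → V)}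
    {x : Fin (d + 1) → V} : Sum.inl ∘ x ∈ pointExtension R P ↔ x ∈ R := by
  refine ⟨?_, fun hx => Or.inl ⟨x, hx, rfl⟩⟩
  rintro (⟨x', hx', h⟩ | ⟨σ, x', -, h⟩)
  · rwa [Sum.inl_injective.comp_left h]
  · exact absurd (congrFun h 0) Sum.inl_ne_inr

theorem cons_mem_pointExtension {R : Set (Fin (d + 1) → V)} {P : Set (Fin d → V)}
    (hP : ∀ x ∈ P, ∀ σ : Equiv.Perm (Fin d), x ∘ σ ∈ P) {x : Fin d → V} :
    Fin.cons (Sum.inr ()) (Sum.inl ∘ x) ∈ pointExtension R P ↔ x ∈ P := by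
  refine ⟨?_, fun hx => Or.inr ⟨1, x, hx, rfl⟩⟩
  rintro (⟨x', -, h⟩ | ⟨σ, x', hx', h⟩)
  · exact absurd (congrFun h 0) Sum.inr_ne_inl
  · obtain ⟨⟨p, τ⟩, rfl⟩ := Equiv.Perm.decomposeFin.symm.surjective σ
    obtain rfl : p = 0 := by
      by_contra hp
      obtain ⟨q, rfl⟩ := Fin.exists_succ_eq.2 hp
      simpa using congrFun h 0
    rw [cons_comp_decomposeFin_symm] at h
    obtain rfl : x ∘ τ = x' := Sum.inl_injective.comp_left (Fin.cons_right_injective _ h)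
    simpa only [Function.comp_assoc, Equiv.self_comp_symm, Function.comp_id] using
      hP _ hx' τ.symm

theorem IsEdgeSet.pointExtension {R : Set (Fin (d + 1) → V)} {P : Set (Fin d → V)}
    (hR : IsEdgeSet π R) (hP : IsLink π ρ Set.univ P) :
    IsEdgeSet (fun n => Sum.elim (π n) fun _ => ρ n) (pointExtension R P) where
  symm y hy τ := by
    rcases hy with ⟨x, hx, rfl⟩ | ⟨σ, x, hx, h⟩
    · exact Or.inl ⟨x ∘ τ, hR.symm x hx τ, rfl⟩
    · refine Or.inr ⟨σ.trans τ.symm, x, hx, h ▸ funext fun i => ?_⟩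
      simp
  injective y hy := by
    rcases hy with ⟨x, hx, rfl⟩ | ⟨σ, x, hx, h⟩
    · exact Sum.inl_injective.comp (hR.injective x hx)
    · rw [← σ.injective_comp y, h, Fin.cons_injective_iff]
      exact ⟨by simp, Sum.inl_injective.comp (hP.injective x hx)⟩
  mem_edges y hy n := by
    rcases hy with ⟨x, hx, rfl⟩ | ⟨σ, x, hx, h⟩
    · exact hR.mem_edges x hx n
    · have mem_cons := hP.cons_mem x hx n trivial
      have comp_eq : (Sum.elim (π n) (fun _ => ρ n) ∘ y) ∘ σ = Fin.cons (ρ n) (π n ∘ x) := by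
        rw [Function.comp_assoc, h, Fin.comp_cons, ← Function.comp_assoc, Sum.elim_comp_inl]
        rfl
      rw [← comp_eq] at mem_cons
      simpa only [Function.comp_assoc, Equiv.self_comp_symm, Function.comp_id] using
        (𝓗.full n).comp_perm_mem mem_cons σ.symm

end Links

section Structures

/-- The structure on `V` with the edge set `R` and with the points lying on the branches `π`. -/
@[reducible]
def structureOf {V : Type*} (R : Set (Fin (d + 1) → V)) (π : ∀ n, V → Fin (𝓗.H n)) :
    𝓗.language.Structure V where
  funMap g := nomatch g
  RelMap {_} r := match r with
    | Rel.R => fun x => x ∈ R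
    | Rel.Q η => fun x => ∀ n hn, η.entry n hn = π n (x 0)

variable {M N : Type*} [𝓗.language.Structure M] [𝓗.language.Structure N]
  {π : ∀ n, M → Fin (𝓗.H n)} {π' : ∀ n, N → Fin (𝓗.H n)}

/-- A map of models of the universal theory that respects branches and edges, as an embedding. -/
def IsBranchMap.embedding (hπ : IsBranchMap π) (hπ' : IsBranchMap π') (f : M ↪ N)
    (hfπ : ∀ n a, π' n (f a) = π n a)
    (hfE : ∀ x : Fin (d + 1) → M, f ∘ x ∈ 𝓗.edges N ↔ x ∈ 𝓗.edges M) : M ↪[𝓗.language] N where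
  toEmbedding := f
  map_fun' g := nomatch g
  map_rel' {n} r x := by
    cases r with
    | R => exact hfE x
    | Q η =>
      have lies_apply_iff : Lies η (f (x 0)) ↔ Lies η (x 0) := by
        simp only [hπ.lies_iff, hπ'.lies_iff, hfπ]
      rw [show x = fun _ => x 0 from funext fun i => congrArg x (Subsingleton.elim i 0)]
      exact lies_apply_iff

/-- The initial segment of length `m` of an infinite branch. -/
def Node.ofBranch (ρ : ∀ n, Fin (𝓗.H n)) (m : ℕ) : 𝓗.Node := ⟨m, fun i => ρ i⟩

theorem IsBranchMap.lies_ofBranch_iff (hπ : IsBranchMap π) {ρ : ∀ n, Fin (𝓗.H n)} {m : ℕ}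
    {a : M} : Lies (Node.ofBranch ρ m) a ↔ ∀ n < m, π n a = ρ n :=
  (hπ.lies_iff _ _).trans (forall₂_congr fun _ _ => eq_comm)

theorem IsBranchMap.apply_embedding (hπ : IsBranchMap π) (hπ' : IsBranchMap π')
    (f : M ↪[𝓗.language] N) (n : ℕ) (a : M) : π' n (f a) = π n a := by
  have lies_a : Lies (Node.ofBranch (fun n => π n a) (n + 1)) a :=
    hπ.lies_ofBranch_iff.2 fun _ _ => rfl
  exact hπ'.lies_ofBranch_iff.1 ((f.map_rel _ _).2 lies_a) n (Nat.lt_succ_self n)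

theorem exists_embedding_point {M : Type u} [𝓗.language.Structure M] {π : ∀ n, M → Fin (𝓗.H n)}
    (hπ : IsBranchMap π) {ρ : ∀ n, Fin (𝓗.H n)} {P : Set (Fin d → M)}
    (hP : IsLink π ρ Set.univ P) :
    ∃ (K : Type u) (_ : 𝓗.language.Structure K) (ι : M ↪[𝓗.language] K) (c : K),
      K ⊨ 𝓗.universalTheory ∧ c ∉ Set.range ι ∧ (∀ m, Lies (Node.ofBranch ρ m) c) ∧
      ∀ x : Fin d → M, Fin.cons c (ι ∘ x) ∈ 𝓗.edges K ↔ x ∈ P := by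
  let _ : 𝓗.language.Structure (M ⊕ Unit) :=
    structureOf (pointExtension (𝓗.edges M) P) fun n => Sum.elim (π n) fun _ => ρ n
  have isBranchMap : IsBranchMap (M := M ⊕ Unit) fun n => Sum.elim (π n) fun _ => ρ n :=
    ⟨fun _ _ => Iff.rfl, hπ.isEdgeSet.pointExtension hP⟩
  exact ⟨M ⊕ Unit, inferInstance,
    hπ.embedding isBranchMap Function.Embedding.inl (fun _ _ => rfl)
      fun _ => inl_comp_mem_pointExtension,
    Sum.inr (), isBranchMap.model, by rintro ⟨_, ⟨⟩⟩,
    fun m => isBranchMap.lies_ofBranch_iff.2 fun _ _ => rfl,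
    fun x => cons_mem_pointExtension hP.symm⟩

end Structures

/-! ### Realizing a point -/

section LocalExtension

/-- The formula with free variables `α` which says that some point outside the given ones satisfies
`Q_η` and has the link prescribed by `G`. -/
noncomputable def pointFormula {α : Type*} [Finite α] (η : 𝓗.Node) (G : Set (Fin d → α)) :
    𝓗.language.Formula α :=
  let point : 𝓗.language.Term (α ⊕ Unit) := Term.var (Sum.inr ())
  let edge (g : Fin d → α) : 𝓗.language.Formula (α ⊕ Unit) :=
    𝓗.relR.formula (Fin.cons point fun l => Term.var (Sum.inl (g l)))
  Formula.iExs Unit <|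
    (Formula.iInf fun a : α => (point.equal (Term.var (Sum.inl a))).not) ⊓
      ((𝓗.relQ η).formula fun _ => point) ⊓
      ((Formula.iInf fun g : G => edge g) ⊓ Formula.iInf fun g : ↥Gᶜ => (edge g).not)

theorem realize_pointFormula {α : Type*} [Finite α] {M : Type*} [𝓗.language.Structure M]
    {η : 𝓗.Node} {G : Set (Fin d → α)} {v : α → M} :
    (pointFormula η G).Realize v ↔ ∃ c ∉ Set.range v, Lies η c ∧
      ∀ g : Fin d → α, Fin.cons c (v ∘ g) ∈ 𝓗.edges M ↔ g ∈ G := by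
  have realize_edge (w : Unit → M) (g : Fin d → α) :
      Formula.Realize (𝓗.relR.formula (Fin.cons (Term.var (Sum.inr ())) fun l =>
        Term.var (Sum.inl (g l)))) (Sum.elim v w) ↔ Fin.cons (w ()) (v ∘ g) ∈ 𝓗.edges M := by
    refine Formula.realize_rel.trans (iff_of_eq (congrArg (RelMap 𝓗.relR) (funext fun i => ?_)))
    cases i using Fin.cases <;> rfl
  have realize_point (w : Unit → M) :
      Formula.Realize ((𝓗.relQ η).formula fun _ => Term.var (Sum.inr ())) (Sum.elim v w) ↔
        Lies η (w ()) :=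
    Formula.realize_rel
  rw [pointFormula, Formula.realize_iExs, (Equiv.funUnique Unit M).symm.surjective.exists]
  refine exists_congr fun c => ?_
  simp only [Formula.realize_inf, Formula.realize_iInf, Formula.realize_not, Formula.realize_equal,
    Term.realize_var, Sum.elim_inl, Sum.elim_inr, realize_edge, realize_point, Set.mem_range,
    not_exists, Subtype.forall, and_assoc]
  refine and_congr (forall_congr' fun a => not_congr eq_comm) (and_congr_right' ?_)
  exact forall_and.symm.trans <| forall_congr' fun g =>
    ⟨fun h => ⟨not_imp_not.1 (h.2 ·), h.1⟩, fun h => ⟨h.2, fun hg => hg ∘ h.1⟩⟩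

variable {T : 𝓗.language.Theory} {f : ℕ → ℕ} {M : Type u} [𝓗.language.Structure M] [Nonempty M]
  {π : ∀ n, M → Fin (𝓗.H n)} {ρ : ∀ n, Fin (𝓗.H n)} {m : ℕ} {P : Set (Fin d → M)}

theorem exists_point (hT : IsModelCompletion.{u} 𝓗.universalTheory T)
    (hf : IsGrowthFunction 𝓗.H 𝓗.E f) (hM : M ⊨ T) (hπ : IsBranchMap π)
    (hP : IsLink π ρ (Set.Iio m) P) (F : Finset M) (hF : ∀ n, m ≤ n → F.card ^ d ≤ f n) :
    ∃ c ∉ F, (∀ n < m, π n c = ρ n) ∧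
      ∀ x : Fin d → M, (∀ l, x l ∈ F) → (Fin.cons c x ∈ 𝓗.edges M ↔ x ∈ P) := by
  obtain ⟨ρ', hρ', hP'⟩ := hP.exists_isLink_univ hf F hF
  obtain ⟨K, _, ι, c, hK, hc, hρc, hPc⟩ := exists_embedding_point hπ hP'
  have : Nonempty K := ⟨c⟩
  obtain ⟨N, _, hN, ⟨j⟩⟩ := hT.exists_embedding K hK
  let φ : 𝓗.language.Formula F :=
    pointFormula (Node.ofBranch ρ' m) {g : Fin d → F | Subtype.val ∘ g ∈ P}
  have realize_N : φ.Realize (j.comp ι ∘ Subtype.val) := by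
    refine realize_pointFormula.2 ⟨j c, ?_, (j.map_rel _ _).2 (hρc m), fun g => ?_⟩
    · rintro ⟨a, ha⟩
      exact hc ⟨a, j.injective ha⟩
    · have comp_eq : (Fin.cons (j c) ((j.comp ι ∘ Subtype.val) ∘ g) : Fin (d + 1) → N) =
          j ∘ Fin.cons c (ι ∘ Subtype.val ∘ g) := (Fin.comp_cons _ _ _).symm
      rw [comp_eq]
      refine (j.map_rel 𝓗.relR _).trans ((hPc _).trans ?_)
      exact and_iff_left fun l => (g l).2
  obtain ⟨c, hcF, hρc, hPc⟩ := realize_pointFormula.1 <|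
    (hT.realize_comp_iff (hT.extends_theory M hM) hM hN (Embedding.refl _ M) (j.comp ι) φ
      Subtype.val).2 realize_N
  exact ⟨c, fun hc => hcF ⟨⟨c, hc⟩, rfl⟩,
    fun n hn => (hπ.lies_ofBranch_iff.1 hρc n hn).trans (hρ' n hn),
    fun x hx => hPc fun l => ⟨x l, hx l⟩⟩

theorem infinite_of_model (hT : IsModelCompletion.{u} 𝓗.universalTheory T) (hM : M ⊨ T) :
    Infinite M := by
  rw [← not_finite_iff_infinite]
  intro
  have := Fintype.ofFinite M
  obtain ⟨f, hf⟩ := 𝓗.exists_growth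
  obtain ⟨π, hπ⟩ := exists_isBranchMap (hT.extends_theory M hM)
  obtain ⟨m, hm⟩ := Filter.eventually_atTop.1
    (hf.tendsto.eventually_ge_atTop ((Finset.univ : Finset M).card ^ d))
  have isLink_empty : IsLink π (fun n => π n (Classical.arbitrary M)) (Set.Iio m) ∅ :=
    ⟨by simp, by simp, by simp⟩
  obtain ⟨c, hc, -⟩ := exists_point hT hf hM hπ isLink_empty Finset.univ hm
  exact hc (Finset.mem_univ c)

end LocalExtension

section Ultrapowers

open Filter Cardinal

variable {I M V : Type u} {D : Ultrafilter I} [𝓗.language.Structure M]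
  {π : ∀ n, M → Fin (𝓗.H n)} {π' : ∀ n, Ultrapower D M → Fin (𝓗.H n)} {ρ : ∀ n, Fin (𝓗.H n)}

theorem cons_mk_mem_edges {c : I → M} {x : Fin d → I → M} :
    Fin.cons (Ultrapower.mk D c) (fun l => Ultrapower.mk D (x l)) ∈ 𝓗.edges (Ultrapower D M) ↔
      ∀ᶠ i in (D : Filter I), Fin.cons (c i) (fun l => x l i) ∈ 𝓗.edges M := by
  have cons_mk : Fin.cons (Ultrapower.mk D c) (fun l => Ultrapower.mk D (x l)) =
      fun j => Ultrapower.mk D ((Fin.cons c x : Fin (d + 1) → I → M) j) :=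
    (Fin.comp_cons (Ultrapower.mk D) c x).symm
  have cons_apply (i : I) : (Fin.cons (c i) fun l => x l i) =
      fun j => (Fin.cons c x : Fin (d + 1) → I → M) j i :=
    (Fin.comp_cons (fun y : I → M => y i) c x).symm
  rw [cons_mk]
  simp only [cons_apply]
  exact Ultrapower.relMap_mk _ _

theorem IsBranchMap.eventually_apply_mk (hπ : IsBranchMap π) (hπ' : IsBranchMap π') (n : ℕ)
    (x : I → M) : ∀ᶠ i in (D : Filter I), π n (x i) = π' n (Ultrapower.mk D x) := by
  have lies_mk : Lies (Node.ofBranch (fun n => π' n (Ultrapower.mk D x)) (n + 1))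
      (Ultrapower.mk D x) :=
    hπ'.lies_ofBranch_iff.2 fun _ _ => rfl
  filter_upwards [(Ultrapower.relMap_mk _ fun _ => x).1 lies_mk] with i hi
  exact hπ.lies_ofBranch_iff.1 hi n (Nat.lt_succ_self n)

theorem IsLink.exists_internal [Infinite I] [Infinite M] (hreg : D.IsRegular)
    (hrg : D.IsGoodForRandomGraph) (hπ : IsBranchMap π) (hπ' : IsBranchMap π') (hV : #V ≤ #I)
    {rep : V → I → M} (hrep : Function.Injective fun a => Ultrapower.mk D (rep a))
    {B : Set (Fin d → V)}
    (hB : IsLink (fun n a => π' n (Ultrapower.mk D (rep a))) ρ Set.univ B) :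
    ∃ (n : I → ℕ) (P : I → Set (Fin d → M)), Tendsto n D atTop ∧
      (∀ i, IsLink π ρ (Set.Iio (n i)) (P i)) ∧
      ∀ x : Fin d → V, ∀ᶠ i in (D : Filter I), (fun l => rep (x l) i) ∈ P i ↔ x ∈ B := by
  have : Nonempty (Fin d) := ⟨⟨0, 𝓗.one_le⟩⟩
  have card_tuples_le : #(Fin d → V) ≤ #I := by
    rw [mk_arrow, mk_fin, lift_natCast, lift_uzero]
    exact (power_le_power_right hV).trans (power_nat_le (aleph0_le_mk I))
  have mk_ne : ∀ x ∈ B, ∀ y ∉ B, Ultrapower.mk D (fun i l => rep (x l) i) ≠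
      Ultrapower.mk D fun i l => rep (y l) i := by
    intro x hx y hy h
    have eq : x = y := funext fun l => hrep <| Ultrapower.mk_eq_mk.2 <|
      (Ultrapower.mk_eq_mk.1 h).mono fun i hi => congrFun hi l
    exact hy (eq ▸ hx)
  obtain ⟨S, hBS, hS⟩ := Ultrapower.exists_internal_separation hrg card_tuples_le mk_ne
  have eventually_cons_mem (x : Fin d → V) (m : ℕ) : ∀ᶠ i in (D : Filter I), x ∈ B →
      (Fin.cons (ρ m) fun l => π m (rep (x l) i) : Fin (d + 1) → Fin (𝓗.H m)) ∈ 𝓗.E m := by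
    filter_upwards [eventually_all.2 fun l => hπ.eventually_apply_mk hπ' m (rep (x l))] with i hi hx
    simpa only [hi, Function.comp_def] using hB.cons_mem x hx m trivial
  obtain ⟨n, hn, hcons⟩ := Ultrapower.overspill hreg hrg card_tuples_le eventually_cons_mem
  refine ⟨n, _, hn, fun i => isLink_linkInside π ρ (Set.Iio (n i)) (S i), fun x => ?_⟩
  by_cases hx : x ∈ B
  · have eventually_perm_mem : ∀ᶠ i in (D : Filter I), ∀ σ : Equiv.Perm (Fin d),
        (fun l => rep (x l) i) ∘ σ ∈ S i :=
      eventually_all.2 fun σ => hBS _ (hB.symm x hx σ)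
    filter_upwards [eventually_perm_mem, hcons x,
      Ultrapower.eventually_injective (hrep.comp (hB.injective x hx))] with i hperm hi hinj
    exact iff_of_true ⟨hperm, hinj, fun k hk => hi k hk hx⟩ hx
  · filter_upwards [hS x hx] with i hi
    exact iff_of_false (fun hP => hi (hP.1 1)) hx

theorem exists_point_ultrapower [Infinite I] [Nonempty M] {T : 𝓗.language.Theory}
    (hT : IsModelCompletion.{u} 𝓗.universalTheory T) (hreg : D.IsRegular) (hflex : D.IsFlexible)
    (hrg : D.IsGoodForRandomGraph) (hM : M ⊨ T) (hπ' : IsBranchMap π') (hV : #V ≤ #I)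
    {v : V → Ultrapower D M} (hv : Function.Injective v) {B : Set (Fin d → V)}
    (hB : IsLink (fun n => π' n ∘ v) ρ Set.univ B) :
    ∃ c ∉ Set.range v, (∀ n, π' n c = ρ n) ∧
      ∀ x : Fin d → V, Fin.cons c (v ∘ x) ∈ 𝓗.edges (Ultrapower D M) ↔ x ∈ B := by
  obtain ⟨π, hπ⟩ := exists_isBranchMap (hT.extends_theory M hM)
  obtain ⟨f, hf⟩ := 𝓗.exists_growth
  have := infinite_of_model hT hM
  choose rep hrep using fun a => Ultrapower.mk_surjective (v a)
  obtain rfl : (fun a => Ultrapower.mk D (rep a)) = v := funext hrep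
  obtain ⟨n, P, hn, hP, hPB⟩ := hB.exists_internal hreg hrg hπ hπ' hV hv
  obtain ⟨r, hr, hrf⟩ := exists_tendsto_atTop_pow_le hf.tendsto (Nat.one_le_iff_ne_zero.1 𝓗.one_le)
  obtain ⟨F, hFr, hF⟩ := Ultrapower.exists_finset_of_isFlexible hflex hV rep (hr.comp hn)
  choose c hcF hcρ hcP using fun i => exists_point hT hf hM hπ (hP i) (F i) fun k hk =>
    (Nat.pow_le_pow_left (hFr i) d).trans (hrf (n i) k hk)
  refine ⟨Ultrapower.mk D c, ?_, fun m => ?_, fun x => ?_⟩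
  · rintro ⟨a, ha⟩
    obtain ⟨i, heq, hmem⟩ := ((Ultrapower.mk_eq_mk.1 ha).and (hF a)).exists
    exact hcF i (heq ▸ hmem)
  · obtain ⟨i, heq, hlt⟩ :=
      ((hπ.eventually_apply_mk hπ' m c).and (hn.eventually_gt_atTop m)).exists
    exact heq.symm.trans (hcρ i m hlt)
  · have eventually_iff : ∀ᶠ i in (D : Filter I),
        (Fin.cons (c i) fun l => rep (x l) i) ∈ 𝓗.edges M ↔ x ∈ B := by
      filter_upwards [eventually_all.2 fun l => hF (x l), hPB x] with i hi hPi
      exact (hcP i _ hi).trans hPi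
    exact cons_mk_mem_edges.trans ((eventually_congr eventually_iff).trans eventually_const)

end Ultrapowers

section Types

variable {V N₁ N₂ : Type u} [𝓗.language.Structure N₁] [𝓗.language.Structure N₂]
  {T : 𝓗.language.Theory} {π₁ : ∀ n, N₁ → Fin (𝓗.H n)} {π₂ : ∀ n, N₂ → Fin (𝓗.H n)}
  {v₁ : V → N₁} {v₂ : V → N₂} {c₁ : N₁} {c₂ : N₂}

theorem comp_elim_mem_edges_iff (hπ₁ : IsBranchMap π₁) (hπ₂ : IsBranchMap π₂)
    (hedges : ∀ x : Fin (d + 1) → V, v₁ ∘ x ∈ 𝓗.edges N₁ ↔ v₂ ∘ x ∈ 𝓗.edges N₂)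
    (hlink : ∀ x : Fin d → V,
      Fin.cons c₁ (v₁ ∘ x) ∈ 𝓗.edges N₁ ↔ Fin.cons c₂ (v₂ ∘ x) ∈ 𝓗.edges N₂)
    (y : Fin (d + 1) → V ⊕ Unit) :
    (Sum.elim v₁ fun _ => c₁) ∘ y ∈ 𝓗.edges N₁ ↔ (Sum.elim v₂ fun _ => c₂) ∘ y ∈ 𝓗.edges N₂ := by
  by_cases hy : Function.Injective y
  · rcases eq_inl_comp_or_comp_perm_eq_cons hy with ⟨x, rfl⟩ | ⟨σ, x, hx⟩
    · exact hedges x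
    · rw [← hπ₁.isEdgeSet.comp_perm_mem_iff σ, ← hπ₂.isEdgeSet.comp_perm_mem_iff σ,
        Function.comp_assoc, Function.comp_assoc, hx, Fin.comp_cons, Fin.comp_cons]
      exact hlink x
  · exact iff_of_false (fun h => hy (hπ₁.isEdgeSet.injective _ h).of_comp)
      fun h => hy (hπ₂.isEdgeSet.injective _ h).of_comp

theorem realize_elim_iff (hT : IsModelCompletion.{u} 𝓗.universalTheory T) (h₁ : N₁ ⊨ T)
    (h₂ : N₂ ⊨ T) (hπ₁ : IsBranchMap π₁) (hπ₂ : IsBranchMap π₂) (hv₁ : Function.Injective v₁)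
    (hv₂ : Function.Injective v₂) (hc₁ : c₁ ∉ Set.range v₁) (hc₂ : c₂ ∉ Set.range v₂)
    (hbranch : ∀ n a, π₁ n (v₁ a) = π₂ n (v₂ a)) (hbranch_point : ∀ n, π₁ n c₁ = π₂ n c₂)
    (hedges : ∀ x : Fin (d + 1) → V, v₁ ∘ x ∈ 𝓗.edges N₁ ↔ v₂ ∘ x ∈ 𝓗.edges N₂)
    (hlink : ∀ x : Fin d → V,
      Fin.cons c₁ (v₁ ∘ x) ∈ 𝓗.edges N₁ ↔ Fin.cons c₂ (v₂ ∘ x) ∈ 𝓗.edges N₂)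
    (φ : 𝓗.language.Formula (V ⊕ Unit)) :
    φ.Realize (Sum.elim v₁ fun _ => c₁) ↔ φ.Realize (Sum.elim v₂ fun _ => c₂) := by
  let w₁ : V ⊕ Unit ↪ N₁ := ⟨Sum.elim v₁ fun _ => c₁,
    hv₁.sumElim (Function.injective_of_subsingleton _) fun a _ h => hc₁ ⟨a, h⟩⟩
  let w₂ : V ⊕ Unit ↪ N₂ := ⟨Sum.elim v₂ fun _ => c₂,
    hv₂.sumElim (Function.injective_of_subsingleton _) fun a _ h => hc₂ ⟨a, h⟩⟩
  let π (n : ℕ) : V ⊕ Unit → Fin (𝓗.H n) := π₁ n ∘ w₁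
  let _ : 𝓗.language.Structure (V ⊕ Unit) := structureOf {y | w₁ ∘ y ∈ 𝓗.edges N₁} π
  have hπ : IsBranchMap π := ⟨fun _ _ => Iff.rfl, hπ₁.isEdgeSet.comap w₁⟩
  let e₁ : V ⊕ Unit ↪[𝓗.language] N₁ := hπ.embedding hπ₁ w₁ (fun _ _ => rfl) fun _ => Iff.rfl
  let e₂ : V ⊕ Unit ↪[𝓗.language] N₂ := hπ.embedding hπ₂ w₂
    (fun n => Sum.rec (fun a => (hbranch n a).symm) fun _ => (hbranch_point n).symm)
    fun y => (comp_elim_mem_edges_iff hπ₁ hπ₂ hedges hlink y).symm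
  exact hT.realize_comp_iff hπ.model h₁ h₂ e₁ e₂ φ id

end Types

end Template

theorem mainTheorem3 {d : ℕ} (𝓗 : Template d) (T : 𝓗.language.Theory)
    (hT : IsModelCompletion.{u} 𝓗.universalTheory T)
    {I : Type u} [Infinite I] (D : Ultrafilter I)
    (hreg : D.IsRegular) (hflex : D.IsFlexible) (hrg : D.IsGoodForRandomGraph)
    (M : Type u) [𝓗.language.Structure M] [Nonempty M] (hM : M ⊨ T) :
    IsSaturated 𝓗.language (Ultrapower D M) (Order.succ (Cardinal.mk I)) := by
  refine isSaturated_of_forall_elementaryEmbedding fun N _ j b hb A hA => ?_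
  have hD : Ultrapower D M ⊨ T := Ultrapower.model hM
  have hN : N ⊨ T := (j.theory_model_iff T).1 hD
  have : Nonempty N := ⟨b⟩
  obtain ⟨π, hπ⟩ := Template.exists_isBranchMap (hT.extends_theory _ hD)
  obtain ⟨ρ, hρ⟩ := Template.exists_isBranchMap (hT.extends_theory N hN)
  have apply_j : ∀ n a, ρ n (j a) = π n a := hπ.apply_embedding hρ j.toEmbedding
  have isLink := hρ.isEdgeSet.isLink (fun a : A => j a) b
  obtain ⟨c, hc, hcb, hlink⟩ := Template.exists_point_ultrapower hT hreg hflex hrg hM hπ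
    (Order.lt_succ_iff.1 hA) Subtype.val_injective
    (by simpa only [Function.comp_def, apply_j] using isLink)
  refine ⟨c, fun φ => (Template.realize_elim_iff hT hN hD hρ hπ
    (j.injective.comp Subtype.val_injective) Subtype.val_injective
    (fun ⟨a, ha⟩ => hb ⟨a, ha⟩) hc (fun n a => apply_j n a) (fun n => (hcb n).symm)
    (fun x => j.toEmbedding.map_rel 𝓗.relR _) (fun x => (hlink x).symm) φ).1⟩
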